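/- Let $X$ be a real Banach space of finite dimension $d$ with a fixed basis $e_1,\dots,e_d$, let $B(x,R)$ denote closed balls, let $d_{\mathcal H}$ be the Hausdorff distance between subsets of $X$ (equal to $\infty$ if exactly one of the two sets is empty), and let $F\subseteq X$ be non-empty. An arithmetic patch of size $k$ and scale $\delta>0$ is a set $\{t+\delta\sum_{i=1}^d x_ie_i : x_1,\dots,x_d\in\{0,\dots,k-1\}\}$ with $t\in X$. For a subset $A$ of a metric space, the Assouad dimension $\dim_{\mathrm A}A\in[0,\infty]$ is the infimum of all $s\ge 0$ for which there is $C>0$ such that, for all $0<r<R$ and all $x\in A$, the set $B(x,R)\cap A$ can be covered by at most $C(R/r)^s$ open sets of diameter at most $r$. A topological embedding $\phi:A\to Y$ into a metric space is quasi-symmetric if there is a homeomorphism $\eta:[0,\infty)\to[0,\infty)$ such that $d(x,a)\le t\,d(x,b)$ implies $d(\phi(x),\phi(a))\le\eta(t)\,d(\phi(x),\phi(b))$ for all $x,a,b\in A$ and $t\ge0$. The conformal Assouad dimension of $F$ is the infimum of $\dim_{\mathrm A}\phi(F)$ over all quasi-symmetric maps $\phi$ from $F$ into metric spaces. A compact set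 $E\subseteq B(0,1)$ is a weak tangent to $F$ if there is a sequence of similarity maps $T_n:X\to X$ (maps multiplying all distances by a positive constant) with $d_{\mathcal H}(E,\,T_n(F)\cap B(0,1))\to0$. Then the following are equivalent: 1. $F$ asymptotically contains arbitrarily large arithmetic patches: for all $k\in\mathbb N$ and $\varepsilon>0$ there are $\delta>0$, an arithmetic patch $P$ of size $k$ and scale $\delta$, and a set $E\subseteq F$ with $d_{\mathcal H}(E,P)\le\varepsilon\delta$; 2. $F$ has the asymptotic Steinhaus property: for every finite $P\subset X$ and $\varepsilon>0$ there are $\delta>0$, $t\in X$ and $E\subseteq F$ with $d_{\mathcal H}(E,t+\delta P)\le\varepsilon\delta$; 3. $\dim_{\mathrm A}F=d$; 4. the conformal Assouad dimension of $F$ equals $d$; 5. $F$ has a weak tangent with non-empty interior; 6. the closed unit ball $B(0,1)$ is a weak tangent to $F$. -/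

import Mathlib

open Set Filter Topology
open scoped NNReal ENNReal

noncomputable section

namespace AssouadPatch

/-- The arithmetic patch of size `k` and scale `δ` based at `t`, with respect to the basis `b`:
the points `t + δ ∑ i, x i • b i` with every `x i` in `{0, …, k - 1}`. -/
def patch {X : Type*} [NormedAddCommGroup X] [NormedSpace ℝ X] {d : ℕ}
    (b : Module.Basis (Fin d) ℝ X) (k : ℕ) (δ : ℝ) (t : X) : Set X :=
  {p | ∃ x : Fin d → ℕ, (∀ i, x i < k) ∧ p = t + δ • ∑ i, (x i : ℝ) • b i}

/-- `F` asymptotically contains arbitrarily large arithmetic patches with respect to `b`.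
The Hausdorff distance is the `[0, ∞]`-valued one, so that the distance between an empty and a
non-empty set is `∞`. -/
def AsymptoticallyContainsPatches {X : Type*} [NormedAddCommGroup X] [NormedSpace ℝ X] {d : ℕ}
    (b : Module.Basis (Fin d) ℝ X) (F : Set X) : Prop :=
  ∀ k : ℕ, ∀ ε : ℝ, 0 < ε → ∃ δ : ℝ, 0 < δ ∧ ∃ t : X, ∃ E : Set X, E ⊆ F ∧
    Metric.hausdorffEDist E (patch b k δ t) ≤ ENNReal.ofReal (ε * δ)

/-- The asymptotic Steinhaus property. -/
def AsymptoticSteinhaus {X : Type*} [NormedAddCommGroup X] [NormedSpace ℝ X]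
    (F : Set X) : Prop :=
  ∀ P : Set X, P.Finite → ∀ ε : ℝ, 0 < ε → ∃ δ : ℝ, 0 < δ ∧ ∃ t : X, ∃ E : Set X, E ⊆ F ∧
    Metric.hausdorffEDist E ((fun p => t + δ • p) '' P) ≤ ENNReal.ofReal (ε * δ)

/-- The least number of open sets of diameter at most `r` needed to cover `E`
(`⊤` if there is no finite cover of this kind). -/
def coverNumber {X : Type*} [MetricSpace X] (r : ℝ) (E : Set X) : ℕ∞ :=
  ⨅ (U : Set (Set X)) (_ : ∀ V ∈ U, IsOpen V ∧ Metric.ediam V ≤ ENNReal.ofReal r)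
    (_ : E ⊆ ⋃₀ U), U.encard

/-- `s` is an admissible exponent for the Assouad dimension of `F`. -/
def IsAssouadExponent {X : Type*} [MetricSpace X] (F : Set X) (s : ℝ≥0) : Prop :=
  ∃ C : ℝ, 0 < C ∧ ∀ R : ℝ, 0 < R → ∀ r : ℝ, 0 < r → r < R → ∀ x ∈ F,
    (coverNumber r (Metric.closedBall x R ∩ F) : ℝ≥0∞) ≤ ENNReal.ofReal (C * (R / r) ^ (s : ℝ))

/-- The Assouad dimension (`∞` if there is no admissible exponent). -/
def assouadDim {X : Type*} [MetricSpace X] (F : Set X) : ℝ≥0∞ :=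
  ⨅ (s : ℝ≥0) (_ : IsAssouadExponent F s), (s : ℝ≥0∞)

/-- Quasi-symmetric maps: topological embeddings `f` for which there is a homeomorphism `η` of
`[0, ∞)` such that `d(x, a) ≤ t d(x, b)` implies `d(f x, f a) ≤ η(t) d(f x, f b)`. -/
def IsQuasisymmetric {X Y : Type*} [MetricSpace X] [MetricSpace Y] (f : X → Y) : Prop :=
  IsEmbedding f ∧ ∃ η : ℝ≥0 ≃ₜ ℝ≥0, ∀ (x a b : X) (t : ℝ≥0),
    nndist x a ≤ t * nndist x b → nndist (f x) (f a) ≤ η t * nndist (f x) (f b)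

universe u

/-- The conformal Assouad dimension: the infimum of the Assouad dimensions of the images of `F`
under quasi-symmetric maps of `F` into arbitrary metric spaces. An image of `F` is in bijection
with a type of the universe of `X`, so this universe loses no image up to isometry. -/
def conformalAssouadDim {X : Type u} [MetricSpace X] (F : Set X) : ℝ≥0∞ :=
  ⨅ (Y : Type u) (_ : MetricSpace Y) (f : F → Y) (_ : IsQuasisymmetric f), assouadDim (range f)

/-- `E` is a weak tangent to `F`: a compact subset of the closed unit ball that is the limit in
Hausdorff distance of the sets `T k (F) ∩ B(0, 1)` for a sequence of similarities `T k`. -/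
def IsWeakTangent {X : Type*} [NormedAddCommGroup X] [NormedSpace ℝ X] (E F : Set X) : Prop :=
  IsCompact E ∧ E ⊆ Metric.closedBall 0 1 ∧ ∃ T : ℕ → Dilation X X,
    Tendsto (fun k => Metric.hausdorffEDist E (T k '' F ∩ Metric.closedBall 0 1)) atTop (𝓝 0)

end AssouadPatch

end

/-!
If `F` leaves in every ball a hole of a fixed relative size, then each cube can be divided into
`N ^ d` cubes one of which misses `F`, and iterating this gives `F` the Assouad exponent
`log (N ^ d - 1) / log N < d`. Hence full Assouad dimension yields balls in which `F` is dense up to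
an arbitrarily small proportion of the radius; placing finite sets in these balls, or rescaling
them to the unit ball, gives the Steinhaus property and the unit ball as a weak tangent.

Conversely, large patches and weak tangents with interior both put copies of the grids
`{0, …, N} ^ d` into `F` that are bilipschitz up to scaling, uniformly in `N`. Let `ρ` run through
the lengths of the images of the edges in one direction under a quasi-symmetric map with gauge `η`,
and let `L` be the span of the image of the grid. Each line of the grid crosses the image, so the
power mean inequality gives `∑ ρ ^ d ≳ L ^ d`. The edges of length at least `r` have initial points
that are `r`-separated up to a constant, so an Assouad exponent `s` of the image allows at most
`C (L / r) ^ s` of them. As `ρ ≲ η (2 / N) L`, if `s < d` then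
`∑ ρ ^ d ≲ η (2 / N) ^ (d - s) L ^ d`, which is a contradiction as `N → ∞`.
-/

namespace AssouadPatch

open Metric MeasureTheory

section AssouadExponents

variable {X Y : Type*} [MetricSpace X] [MetricSpace Y] {F : Set X} {s : ℝ≥0}

theorem coverNumber_le_card {r : ℝ} {E : Set X} (S : Finset X) (hE : E ⊆ ⋃ c ∈ S, ball c (r / 2)) :
    coverNumber r E ≤ S.card := by
  have hcover : coverNumber r E ≤ ((ball · (r / 2)) '' (S : Set X)).encard := by
    refine iInf₂_le_of_le _ ?_ (iInf_le _ (by rwa [sUnion_image]))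
    rintro _ ⟨c, -, rfl⟩
    refine ⟨isOpen_ball, ediam_le fun y hy z hz => ?_⟩
    rw [edist_dist]
    refine ENNReal.ofReal_le_ofReal ?_
    linarith [dist_triangle_right y z c, mem_ball.1 hy, mem_ball.1 hz]
  exact hcover.trans ((encard_image_le _ _).trans (encard_coe_eq_coe_finsetCard S).le)

theorem card_le_coverNumber {ι : Type*} {r : ℝ} {E : Set X} (A : Finset ι) (y : ι → X)
    (hyE : ∀ i ∈ A, y i ∈ E) (hr : 0 ≤ r)
    (hsep : (A : Set ι).Pairwise fun i j => r < dist (y i) (y j)) :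
    (A.card : ℕ∞) ≤ coverNumber r E := by
  refine le_iInf fun U => le_iInf fun hU => le_iInf fun hE => ?_
  have hmem : ∀ i ∈ A, ∃ V ∈ U, y i ∈ V := fun i hi => hE (hyE i hi)
  choose! V hVU hyV using hmem
  rw [← encard_coe_eq_coe_finsetCard]
  refine encard_le_encard_of_injOn (f := V) hVU fun i hi j hj hij => ?_
  by_contra hne
  have hdist := (edist_le_ediam_of_mem (hyV i hi) (hij ▸ hyV j hj)).trans (hU _ (hVU i hi)).2
  rw [edist_dist, ENNReal.ofReal_le_ofReal_iff hr] at hdist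
  exact (hsep hi hj hne).not_ge hdist

theorem coverNumber_le_coverNumber_image {f : X → Y} {K : ℝ≥0} (hf : Continuous f)
    (hfK : AntilipschitzWith K f) {r r' : ℝ} (hr : K * r' ≤ r) (E : Set X) :
    coverNumber r E ≤ coverNumber r' (f '' E) := by
  refine le_iInf fun U => le_iInf fun hU => le_iInf fun hE => ?_
  refine (iInf₂_le_of_le ((f ⁻¹' ·) '' U) ?_ (iInf_le _ ?_)).trans (encard_image_le _ _)
  · rintro _ ⟨V, hV, rfl⟩
    refine ⟨(hU V hV).1.preimage hf, (hfK.ediam_preimage_le V).trans ?_⟩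
    calc (K : ℝ≥0∞) * ediam V ≤ K * ENNReal.ofReal r' := by gcongr; exact (hU V hV).2
      _ = ENNReal.ofReal (K * r') := by
        rw [ENNReal.ofReal_mul K.coe_nonneg, ENNReal.ofReal_coe_nnreal]
      _ ≤ ENNReal.ofReal r := ENNReal.ofReal_le_ofReal hr
  · rwa [sUnion_image, ← preimage_iUnion₂, ← sUnion_eq_biUnion, ← image_subset_iff]

theorem assouadDim_le (h : IsAssouadExponent F s) : assouadDim F ≤ s :=
  iInf₂_le s h

theorem IsAssouadExponent.of_image {f : X → Y} {K L : ℝ≥0} (hfL : LipschitzWith L f)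
    (hfK : AntilipschitzWith K f) (h : IsAssouadExponent (f '' F) s) : IsAssouadExponent F s := by
  obtain ⟨C, hC, hcover⟩ := h
  refine ⟨C * ((L + 1) * (K + 1)) ^ (s : ℝ), by positivity, fun R hR r hr hrR x hx => ?_⟩
  have hrR' : r / (K + 1) < (L + 1) * R :=
    calc r / (K + 1) ≤ r := div_le_self hr.le (by simp)
      _ < R := hrR
      _ ≤ (L + 1) * R := le_mul_of_one_le_left hR.le (by simp)
  have himage : f '' (closedBall x R ∩ F) ⊆ closedBall (f x) ((L + 1) * R) ∩ f '' F := by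
    rintro _ ⟨y, ⟨hy, hyF⟩, rfl⟩
    refine ⟨mem_closedBall.2 ((hfL.dist_le_mul y x).trans ?_), mem_image_of_mem f hyF⟩
    gcongr
    exacts [by simp, hy]
  have hmono : coverNumber r (closedBall x R ∩ F) ≤
      coverNumber (r / (K + 1)) (closedBall (f x) ((L + 1) * R) ∩ f '' F) := by
    refine (coverNumber_le_coverNumber_image hfL.continuous hfK ?_ _).trans
      (iInf_mono fun U => iInf_mono fun _ => iInf_mono' fun hE => ⟨himage.trans hE, le_rfl⟩)
    rw [mul_div_assoc', div_le_iff₀ (by positivity)]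
    nlinarith
  refine (ENat.toENNReal_le.2 hmono).trans ((hcover _ (by positivity) _ (by positivity) hrR' _
    (mem_image_of_mem f hx)).trans (ENNReal.ofReal_le_ofReal (le_of_eq ?_)))
  rw [mul_assoc C, ← Real.mul_rpow (by positivity) (by positivity)]
  congr 2
  field_simp

theorem IsAssouadExponent.exists_card_le (h : IsAssouadExponent F s) : ∃ C : ℝ, 0 < C ∧
    ∀ {ι : Type*} (A : Finset ι) (y : ι → X) {x : X} {r R : ℝ}, x ∈ F → 0 < r → r < R →
      (∀ i ∈ A, y i ∈ closedBall x R ∩ F) →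
      ((A : Set ι).Pairwise fun i j => r < dist (y i) (y j)) →
      (A.card : ℝ) ≤ C * (R / r) ^ (s : ℝ) := by
  obtain ⟨C, hC, hcover⟩ := h
  refine ⟨C, hC, fun {_} A y {x r R} hx hr hrR hy hsep => ?_⟩
  have hR := hr.trans hrR
  have hcard := (ENat.toENNReal_le.2 (card_le_coverNumber A y hy hr.le hsep)).trans
    (hcover R hR r hr hrR x hx)
  rwa [ENat.toENNReal_coe, ← ENNReal.ofReal_natCast,
    ENNReal.ofReal_le_ofReal_iff (by positivity)] at hcard

theorem exists_closedBall_cover_pow {M : ℕ} {q : ℝ} (hq : 0 < q)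
    (h : ∀ (a : X) (R : ℝ), 0 < R → ∃ S : Finset X, S.card ≤ M ∧
      closedBall a R ∩ F ⊆ ⋃ c ∈ S, closedBall c (R / q)) (n : ℕ) (a : X) {R : ℝ} (hR : 0 < R) :
    ∃ S : Finset X, S.card ≤ M ^ n ∧ closedBall a R ∩ F ⊆ ⋃ c ∈ S, closedBall c (R / q ^ n) := by
  classical
  induction n with
  | zero => exact ⟨{a}, by simp, by simp⟩
  | succ n ih =>
    obtain ⟨S, hS, hcover⟩ := ih
    choose T hT hTcover using fun c => h c (R / q ^ n) (by positivity)
    refine ⟨S.biUnion T, ?_, fun x hx => ?_⟩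
    · rw [pow_succ]
      exact (Finset.card_biUnion_le_card_mul S T M fun c _ => hT c).trans
        (Nat.mul_le_mul_right M hS)
    · obtain ⟨c, hc, hxc⟩ := mem_iUnion₂.1 (hcover hx)
      obtain ⟨c', hc', hxc'⟩ := mem_iUnion₂.1 (hTcover c ⟨hxc, hx.2⟩)
      rw [div_div, ← pow_succ] at hxc'
      exact mem_iUnion₂.2 ⟨c', Finset.mem_biUnion.2 ⟨c, hc, hc'⟩, hxc'⟩

theorem isAssouadExponent_of_closedBall_cover {M : ℕ} {q : ℝ} (hq : 1 < q)
    (hM : (M : ℝ) ≤ q ^ (s : ℝ))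
    (h : ∀ (a : X) (R : ℝ), 0 < R → ∃ S : Finset X, S.card ≤ M ∧
      closedBall a R ∩ F ⊆ ⋃ c ∈ S, closedBall c (R / q)) : IsAssouadExponent F s := by
  have hq0 : 0 < q := one_pos.trans hq
  refine ⟨(2 * q) ^ (s : ℝ), by positivity, fun R hR r hr hrR x _ => ?_⟩
  have hRr : 1 ≤ 2 * R / r := (one_le_div hr).2 (by linarith)
  obtain ⟨n, hn, hn'⟩ := exists_nat_pow_near hRr hq
  obtain ⟨S, hS, hcover⟩ := exists_closedBall_cover_pow hq0 h (n + 1) x hR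
  have hsmall : R / q ^ (n + 1) < r / 2 := by
    rw [div_lt_iff₀ hr] at hn'
    rw [div_lt_iff₀ (by positivity)]
    linarith
  have hcard : coverNumber r (closedBall x R ∩ F) ≤ S.card :=
    coverNumber_le_card S (hcover.trans (iUnion₂_mono fun c _ => closedBall_subset_ball hsmall))
  refine (ENat.toENNReal_le.2 hcard).trans ?_
  rw [ENat.toENNReal_coe, ← ENNReal.ofReal_natCast]
  refine ENNReal.ofReal_le_ofReal ?_
  calc (S.card : ℝ) ≤ (M : ℝ) ^ (n + 1) := by exact_mod_cast hS
    _ ≤ (q ^ (s : ℝ)) ^ (n + 1) := by gcongr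
    _ = (q ^ n * q) ^ (s : ℝ) := by
      rw [← pow_succ, ← Real.rpow_natCast, ← Real.rpow_natCast, ← Real.rpow_mul hq0.le,
        ← Real.rpow_mul hq0.le, mul_comm]
    _ ≤ (2 * R / r * q) ^ (s : ℝ) := by gcongr
    _ = (2 * q) ^ (s : ℝ) * (R / r) ^ (s : ℝ) := by
      rw [← Real.mul_rpow (by positivity) (by positivity)]
      congr 1
      ring

end AssouadExponents

/-- `F` is relatively dense in balls: for every `ε` there is a ball, of some radius `R`, all of
whose points are within `ε R` of `F`. The negation says that `F` is uniformly porous. -/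
def IsAlmostDenseInBalls {X : Type*} [MetricSpace X] (F : Set X) : Prop :=
  ∀ ε : ℝ, 0 < ε → ∃ (x : X) (R : ℝ), 0 < R ∧ ∀ y ∈ closedBall x R, ∃ z ∈ F, dist y z ≤ ε * R

theorem IsAlmostDenseInBalls.of_image {X Y : Type*} [MetricSpace X] [MetricSpace Y] {F : Set X}
    (e : X ≃ Y) {K L : ℝ≥0} (heL : LipschitzWith L e) (heK : AntilipschitzWith K e)
    (h : IsAlmostDenseInBalls (e '' F)) : IsAlmostDenseInBalls F := by
  intro ε hε
  obtain ⟨x, R, hR, hx⟩ := h (ε / ((K + 1) * (L + 1))) (by positivity)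
  refine ⟨e.symm x, R / (L + 1), by positivity, fun y hy => ?_⟩
  have hey : e y ∈ closedBall x R := by
    have hdist := heL.dist_le_mul y (e.symm x)
    rw [e.apply_symm_apply] at hdist
    refine mem_closedBall.2 (hdist.trans ?_)
    calc L * dist y (e.symm x) ≤ (L + 1) * (R / (L + 1)) := by
          gcongr
          exacts [by simp, hy]
      _ = R := by field_simp
  obtain ⟨_, ⟨z, hz, rfl⟩, hyz⟩ := hx (e y) hey
  refine ⟨z, hz, (heK.le_mul_dist y z).trans ?_⟩
  calc K * dist (e y) (e z) ≤ (K + 1) * (ε / ((K + 1) * (L + 1)) * R) := by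
        gcongr
        simp
    _ = ε * (R / (L + 1)) := by field_simp

section Coordinates

variable {ι : Type*} {N : ℕ} {F : Set (ι → ℝ)}

theorem exists_abs_sub_le_div {u R : ℝ} (hN : 0 < N) (hu : |u| ≤ R) :
    ∃ k : Fin N, |u - (2 * k + 1 - N) * (R / N)| ≤ R / N := by
  obtain rfl | hR := ((abs_nonneg u).trans hu).eq_or_lt
  · exact ⟨⟨0, hN⟩, by simpa using hu⟩
  have hN' : (0 : ℝ) < N := Nat.cast_pos.2 hN
  obtain ⟨hu₁, hu₂⟩ := abs_le.1 hu
  obtain ⟨v, hv⟩ : ∃ v, u = (2 * v - N) * (R / N) := ⟨(u + R) * N / (2 * R), by field_simp; ring⟩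
  have hRN : R = N * (R / N) := by field_simp
  have hv₀ : 0 ≤ v := by
    by_contra! hlt
    nlinarith [mul_pos_of_neg_of_neg hlt (neg_lt_zero.2 (div_pos hR hN'))]
  have hvN : v ≤ N := by
    by_contra! hlt
    nlinarith [mul_pos (sub_pos.2 hlt) (div_pos hR hN')]
  obtain ⟨k, hk₁, hk₂⟩ : ∃ k : Fin N, (k : ℝ) ≤ v ∧ v ≤ k + 1 := by
    obtain rfl | hv₀ := hv₀.eq_or_lt
    · exact ⟨⟨0, hN⟩, by simp⟩
    have hpos : 0 < ⌈v⌉₊ := Nat.ceil_pos.2 hv₀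
    have hle : ⌈v⌉₊ ≤ N := Nat.ceil_le.2 hvN
    have hcast : ((⌈v⌉₊ - 1 : ℕ) : ℝ) = ⌈v⌉₊ - 1 := Nat.cast_pred hpos
    refine ⟨⟨⌈v⌉₊ - 1, by omega⟩, ?_, ?_⟩
    · linarith [Nat.ceil_lt_add_one hv₀.le]
    · linarith [Nat.le_ceil v]
  refine ⟨k, ?_⟩
  rw [hv, ← sub_mul, abs_mul, abs_of_pos (div_pos hR hN')]
  exact mul_le_of_le_one_left (by positivity) (abs_le.2 ⟨by linarith, by linarith⟩)

/-- The centres of the cubes of radius `R / N` into which the cube of radius `R` about `a`, which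
is a closed ball of the supremum norm, is divided. -/
noncomputable def subcenter (N : ℕ) (a : ι → ℝ) (R : ℝ) (k : ι → Fin N) : ι → ℝ :=
  fun i => a i + (2 * k i + 1 - N) * (R / N)

variable [Fintype ι]

theorem exists_mem_closedBall_subcenter (hN : 0 < N) {a x : ι → ℝ} {R : ℝ}
    (hx : x ∈ closedBall a R) : ∃ k, x ∈ closedBall (subcenter N a R k) (R / N) := by
  have hR : 0 ≤ R := dist_nonneg.trans hx
  choose k hk using fun i => exists_abs_sub_le_div hN ((dist_le_pi_dist x a i).trans hx)
  refine ⟨k, (dist_pi_le_iff (by positivity)).2 fun i => ?_⟩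
  rw [Real.dist_eq, subcenter, ← sub_sub]
  exact hk i

theorem isAssouadExponent_card (F : Set (ι → ℝ)) : IsAssouadExponent F (Fintype.card ι) := by
  classical
  refine isAssouadExponent_of_closedBall_cover (M := 2 ^ Fintype.card ι) one_lt_two (by simp)
    fun a R _ => ⟨Finset.univ.image (subcenter 2 a R),
      Finset.card_image_le.trans (by simp), fun x hx => ?_⟩
  obtain ⟨k, hk⟩ := exists_mem_closedBall_subcenter two_pos hx.1
  exact mem_iUnion₂.2 ⟨_, Finset.mem_image_of_mem _ (Finset.mem_univ k), by exact_mod_cast hk⟩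

/-- A hole of relative size `ε` contains one of the `N ^ n` small cubes as soon as `2 ≤ ε N`. -/
theorem exists_closedBall_cover_of_hole {a y : ι → ℝ} {R ε : ℝ} (hN : 0 < N)
    (hεN : 2 ≤ ε * N) (hR : 0 ≤ R) (hy : y ∈ closedBall a R)
    (hhole : ∀ z ∈ F, ε * R < dist y z) :
    ∃ S : Finset (ι → ℝ), S.card ≤ N ^ Fintype.card ι - 1 ∧
      closedBall a R ∩ F ⊆ ⋃ c ∈ S, closedBall c (R / N) := by
  classical
  obtain ⟨k₀, hk₀⟩ := exists_mem_closedBall_subcenter hN hy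
  refine ⟨(Finset.univ.erase k₀).image (subcenter N a R), Finset.card_image_le.trans ?_,
    fun x hx => ?_⟩
  · rw [Finset.card_erase_of_mem (Finset.mem_univ _)]
    simp
  obtain ⟨k, hk⟩ := exists_mem_closedBall_subcenter hN hx.1
  refine mem_iUnion₂.2 ⟨_, Finset.mem_image_of_mem _
    (Finset.mem_erase.2 ⟨?_, Finset.mem_univ k⟩), hk⟩
  rintro rfl
  have hsmall : 2 * (R / N) ≤ ε * R := by
    rw [mul_div_assoc', div_le_iff₀ (Nat.cast_pos.2 hN)]
    nlinarith
  linarith [hhole x hx.2, dist_triangle_right y x (subcenter N a R k), mem_closedBall.1 hk,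
    mem_closedBall.1 hk₀]

theorem exists_isAssouadExponent_lt_card [Nonempty ι] (hF : ¬IsAlmostDenseInBalls F) :
    ∃ s : ℝ≥0, s < Fintype.card ι ∧ IsAssouadExponent F s := by
  simp only [IsAlmostDenseInBalls, not_forall] at hF
  obtain ⟨ε, hε, hF⟩ := hF
  push Not at hF
  obtain ⟨N, hN⟩ := exists_nat_ge (max 2 (2 / ε))
  have hN₂ : 2 ≤ N := by exact_mod_cast (le_max_left _ _).trans hN
  have hεN : 2 ≤ ε * N := (div_le_iff₀' hε).1 ((le_max_right _ _).trans hN)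
  have hN₁ : (1 : ℝ) < N := by exact_mod_cast hN₂
  have hpow : 2 ≤ N ^ Fintype.card ι := hN₂.trans (Nat.le_self_pow Fintype.card_ne_zero N)
  obtain ⟨M, hM⟩ : ∃ M, N ^ Fintype.card ι = M + 1 := ⟨_, (Nat.sub_add_cancel (by omega)).symm⟩
  have hM₁ : (1 : ℝ) ≤ M := by exact_mod_cast (by omega : 1 ≤ M)
  have hlog : (N : ℝ) ^ Real.logb N M = M :=
    Real.rpow_logb (by linarith) hN₁.ne' (by linarith)
  lift Real.logb N M to ℝ≥0 using Real.logb_nonneg hN₁ hM₁ with s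
  refine ⟨s, ?_, isAssouadExponent_of_closedBall_cover hN₁ hlog.ge ?_⟩
  · rw [← NNReal.coe_lt_coe, NNReal.coe_natCast, ← Real.rpow_lt_rpow_left_iff hN₁, hlog,
      Real.rpow_natCast]
    exact_mod_cast (by omega : M < N ^ Fintype.card ι)
  · intro a R hR
    obtain ⟨y, hy, hhole⟩ := hF a R hR
    simpa [hM] using exists_closedBall_cover_of_hole (by omega) hεN hR.le hy hhole

end Coordinates

section FiniteDimensional

variable {X : Type*} [NormedAddCommGroup X] [NormedSpace ℝ X] {d : ℕ}

theorem IsAssouadExponent.of_image_equivFunL (b : Module.Basis (Fin d) ℝ X) {F : Set X} {s : ℝ≥0}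
    (h : IsAssouadExponent (b.equivFunL '' F) s) : IsAssouadExponent F s :=
  h.of_image b.equivFunL.lipschitz b.equivFunL.antilipschitz

theorem assouadDim_le_of_basis (b : Module.Basis (Fin d) ℝ X) (F : Set X) : assouadDim F ≤ d := by
  have h := isAssouadExponent_card (b.equivFunL '' F)
  rw [Fintype.card_fin] at h
  exact_mod_cast assouadDim_le (h.of_image_equivFunL b)

theorem isAlmostDenseInBalls_of_assouadDim_eq (b : Module.Basis (Fin d) ℝ X) {F : Set X}
    (hF : F.Nonempty) (hdim : assouadDim F = d) : IsAlmostDenseInBalls F := by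
  obtain rfl | hd := Nat.eq_zero_or_pos d
  · obtain ⟨z, hz⟩ := hF
    have : Subsingleton X := b.equivFunL.injective.subsingleton
    exact fun ε hε => ⟨z, 1, one_pos, fun y _ => ⟨z, hz, by simp [Subsingleton.elim y z, hε.le]⟩⟩
  have : Nonempty (Fin d) := ⟨⟨0, hd⟩⟩
  refine IsAlmostDenseInBalls.of_image b.equivFunL.toEquiv b.equivFunL.lipschitz
    b.equivFunL.antilipschitz (by_contra fun hporous => ?_)
  obtain ⟨s, hsd, hs⟩ := exists_isAssouadExponent_lt_card hporous
  rw [Fintype.card_fin] at hsd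
  have hds := assouadDim_le (hs.of_image_equivFunL b)
  rw [hdim] at hds
  exact hsd.not_ge (by exact_mod_cast hds)

end FiniteDimensional

section PowerSums

theorem lintegral_rpow_le_of_meas_le {α : Type*} [MeasurableSpace α] {μ : Measure α} {f : α → ℝ}
    {C M s p : ℝ} (hp : 0 < p) (hsp : s < p) (hC : 0 ≤ C) (hM : 0 ≤ M) (hf : AEMeasurable f μ)
    (hf₀ : 0 ≤ᵐ[μ] f) (hfM : ∀ᵐ a ∂μ, f a ≤ M)
    (htail : ∀ r, 0 < r → μ {a | r ≤ f a} ≤ ENNReal.ofReal (C * r ^ (-s))) :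
    ∫⁻ a, ENNReal.ofReal (f a ^ p) ∂μ ≤
      ENNReal.ofReal (p * (C * (M ^ (p - s) / (p - s)))) := by
  have hexp : -1 < p - s - 1 := by linarith
  have hpow : ∀ t ∈ Ioc 0 M, 0 ≤ C * t ^ (p - s - 1) := fun t ht =>
    mul_nonneg hC (Real.rpow_nonneg ht.1.le _)
  have htail' : ∀ t ∈ Ioi (0 : ℝ), μ {a | t ≤ f a} * ENNReal.ofReal (t ^ (p - 1)) ≤
      (Iic M).indicator (fun t => ENNReal.ofReal (C * t ^ (p - s - 1))) t := by
    intro t ht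
    by_cases htM : t ≤ M
    · rw [indicator_of_mem (mem_Iic.2 htM), sub_right_comm, sub_eq_neg_add (p - 1),
        Real.rpow_add ht, ← mul_assoc,
        ENNReal.ofReal_mul (mul_nonneg hC (Real.rpow_nonneg (le_of_lt ht) _))]
      gcongr
      exact htail t ht
    · have hnull : μ {a | t ≤ f a} = 0 := measure_mono_null
        (fun a hta hfa => htM (le_trans hta hfa)) (ae_iff.1 hfM)
      simp [hnull]
  have hint : IntegrableOn (fun t => C * t ^ (p - s - 1)) (Ioc 0 M) :=
    (((intervalIntegral.intervalIntegrable_rpow' hexp).const_mul C).1)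
  rw [lintegral_rpow_eq_lintegral_meas_le_mul μ hf₀ hf hp, ENNReal.ofReal_mul hp.le]
  gcongr
  calc ∫⁻ t in Ioi 0, μ {a | t ≤ f a} * ENNReal.ofReal (t ^ (p - 1))
      ≤ ∫⁻ t in Ioi 0, (Iic M).indicator (fun t => ENNReal.ofReal (C * t ^ (p - s - 1))) t :=
        setLIntegral_mono' measurableSet_Ioi htail'
    _ = ∫⁻ t in Ioc 0 M, ENNReal.ofReal (C * t ^ (p - s - 1)) := by
        rw [setLIntegral_indicator measurableSet_Iic, inter_comm, Ioi_inter_Iic]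
    _ = ENNReal.ofReal (∫ t in Ioc 0 M, C * t ^ (p - s - 1)) :=
        (ofReal_integral_eq_lintegral_ofReal hint
          ((ae_restrict_iff' measurableSet_Ioc).2 (ae_of_all _ hpow))).symm
    _ = ENNReal.ofReal (C * (M ^ (p - s) / (p - s))) := by
        rw [← intervalIntegral.integral_of_le hM, intervalIntegral.integral_const_mul,
          integral_rpow (Or.inl hexp), sub_add_cancel, Real.zero_rpow (by linarith), sub_zero]

theorem sum_rpow_le_of_card_le {ι : Type*} (A : Finset ι) {ρ : ι → ℝ} {C M s p : ℝ} (hp : 0 < p)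
    (hsp : s < p) (hC : 0 ≤ C) (hM : 0 ≤ M) (hρ₀ : ∀ i ∈ A, 0 ≤ ρ i) (hρM : ∀ i ∈ A, ρ i ≤ M)
    (hcard : ∀ r, 0 < r → ∀ B ⊆ A, (∀ i ∈ B, r ≤ ρ i) → (B.card : ℝ) ≤ C * r ^ (-s)) :
    ∑ i ∈ A, ρ i ^ p ≤ p * (C * (M ^ (p - s) / (p - s))) := by
  classical
  let _ : MeasurableSpace A := ⊤
  have htail : ∀ r, 0 < r →
      Measure.count {i : A | r ≤ ρ i} ≤ ENNReal.ofReal (C * r ^ (-s)) := by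
    intro r hr
    have hB := hcard r hr ((Finset.univ.filter fun i : A => r ≤ ρ i).map (.subtype _))
      (Finset.map_subtype_subset _) (by simp +contextual)
    rw [Finset.card_map] at hB
    rw [← Finset.coe_filter_univ, Measure.count_apply_finset, ← ENNReal.ofReal_natCast]
    exact ENNReal.ofReal_le_ofReal hB
  have hsum := lintegral_rpow_le_of_meas_le (μ := Measure.count) hp hsp hC hM
    (f := fun i : A => ρ i) (Measurable.of_discrete.aemeasurable) (ae_of_all _ fun i => hρ₀ i i.2)
    (ae_of_all _ fun i => hρM i i.2) htail
  rw [lintegral_count, tsum_fintype, Finset.sum_coe_sort A fun i => ENNReal.ofReal (ρ i ^ p),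
    ← ENNReal.ofReal_sum_of_nonneg fun i hi => Real.rpow_nonneg (hρ₀ i hi) p] at hsum
  refine (ENNReal.ofReal_le_ofReal_iff ?_).1 hsum
  have : 0 < p - s := by linarith
  positivity

end PowerSums

section Quasisymmetry

variable {X Y Z : Type*} [MetricSpace X] [MetricSpace Y] [MetricSpace Z]

/-- `f` is quasi-symmetric on `S` with gauge `η`. In contrast to `IsQuasisymmetric`, the gauge is
explicit, and neither `η` nor `f` is required to be a homeomorphism onto its image. -/
def IsQuasisymmetricOn (η : ℝ≥0 → ℝ≥0) (f : X → Y) (S : Set X) : Prop :=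
  ∀ x ∈ S, ∀ a ∈ S, ∀ c ∈ S, ∀ t : ℝ≥0, dist x a ≤ t * dist x c →
    dist (f x) (f a) ≤ η t * dist (f x) (f c)

theorem IsQuasisymmetricOn.comp {η θ : ℝ≥0 → ℝ≥0} {g : Y → Z} {f : X → Y} {S : Set X} {T : Set Y}
    (hg : IsQuasisymmetricOn θ g T) (hf : IsQuasisymmetricOn η f S) (hST : MapsTo f S T) :
    IsQuasisymmetricOn (θ ∘ η) (g ∘ f) S :=
  fun x hx a ha c hc t h => hg _ (hST hx) _ (hST ha) _ (hST hc) (η t) (hf x hx a ha c hc t h)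

theorem IsQuasisymmetric.exists_isQuasisymmetricOn_univ {f : X → Y} (hf : IsQuasisymmetric f) :
    ∃ η : ℝ≥0 ≃ₜ ℝ≥0, IsQuasisymmetricOn η f univ := by
  obtain ⟨-, η, hη⟩ := hf
  exact ⟨η, fun x _ a _ c _ t h => by exact_mod_cast hη x a c t (by exact_mod_cast h)⟩

theorem homeomorph_nnreal_zero (η : ℝ≥0 ≃ₜ ℝ≥0) : η 0 = 0 := by
  have hη : Monotone η := by
    refine ((η.continuous.strictMono_of_inj η.injective).resolve_right fun h => ?_).monotone
    exact not_bddAbove_univ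
      ⟨η 0, fun y _ => (η.apply_symm_apply y).symm.trans_le (h.antitone (zero_le))⟩
  exact nonpos_iff_eq_zero.1 ((hη (zero_le)).trans_eq (η.apply_symm_apply 0))

end Quasisymmetry

section Grids

open Matrix (vecCons)

/-- The integer grid `{0, …, N} ^ d`, with `N + 1` points on each side. -/
def grid (d N : ℕ) : Set (Fin d → ℕ) :=
  {g | ∀ i, g i ≤ N}

/-- The initial points `(j, h)` of the edges from `(j, h)` to `(j + 1, h)`, where `(j, h)` runs
through `{0, …, N - 1} ^ (m + 1)`. -/
def edgeIndex (m N : ℕ) : Finset (ℕ × (Fin m → ℕ)) :=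
  Finset.range N ×ˢ Fintype.piFinset fun _ => Finset.range N

variable {m N : ℕ}

theorem zero_mem_grid {d : ℕ} : (0 : Fin d → ℕ) ∈ grid d N :=
  fun _ => Nat.zero_le N

theorem vecCons_mem_grid {j : ℕ} {h : Fin m → ℕ} :
    vecCons j h ∈ grid (m + 1) N ↔ j ≤ N ∧ h ∈ grid m N :=
  Fin.forall_fin_succ

theorem dist_le_of_mem_grid {d : ℕ} {g h : Fin d → ℕ} (hg : g ∈ grid d N) (hh : h ∈ grid d N) :
    dist g h ≤ N := by
  refine (dist_pi_le_iff N.cast_nonneg).2 fun i => ?_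
  rw [Nat.dist_eq]
  exact abs_sub_le_of_nonneg_of_le (Nat.cast_nonneg _) (Nat.cast_le.2 (hg i)) (Nat.cast_nonneg _)
    (Nat.cast_le.2 (hh i))

theorem one_le_dist_of_ne {d : ℕ} {g h : Fin d → ℕ} (hne : g ≠ h) : 1 ≤ dist g h := by
  obtain ⟨i, hi⟩ := Function.ne_iff.1 hne
  exact (Nat.pairwise_one_le_dist hi).trans (dist_le_pi_dist g h i)

theorem dist_vecCons (j k : ℕ) (h h' : Fin m → ℕ) :
    dist (vecCons j h) (vecCons k h') = max (dist j k) (dist h h') := by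
  simpa only [Fin.insertNth_zero', vecCons] using
    Fin.dist_insertNth_insertNth (α := fun _ => ℕ) 0 j k h h'

theorem mem_edgeIndex {q : ℕ × (Fin m → ℕ)} :
    q ∈ edgeIndex m N ↔ q.1 < N ∧ ∀ i, q.2 i < N := by
  simp [edgeIndex]

theorem card_edgeIndex (m N : ℕ) : (edgeIndex m N).card = N ^ (m + 1) := by
  simp [edgeIndex, pow_succ']

theorem vecCons_mem_grid_of_mem_edgeIndex {q : ℕ × (Fin m → ℕ)} (hq : q ∈ edgeIndex m N) :
    vecCons q.1 q.2 ∈ grid (m + 1) N :=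
  vecCons_mem_grid.2 ⟨(mem_edgeIndex.1 hq).1.le, fun i => ((mem_edgeIndex.1 hq).2 i).le⟩

theorem vecCons_succ_mem_grid_of_mem_edgeIndex {q : ℕ × (Fin m → ℕ)} (hq : q ∈ edgeIndex m N) :
    vecCons (q.1 + 1) q.2 ∈ grid (m + 1) N :=
  vecCons_mem_grid.2 ⟨(mem_edgeIndex.1 hq).1, fun i => ((mem_edgeIndex.1 hq).2 i).le⟩

theorem dist_vecCons_succ (j : ℕ) (h : Fin m → ℕ) :
    dist (vecCons j h) (vecCons (j + 1) h) = 1 := by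
  simp [dist_vecCons, Nat.dist_eq]

variable {Y : Type*} [MetricSpace Y] {η : ℝ≥0 → ℝ≥0} {y : (Fin (m + 1) → ℕ) → Y}

/-- The length of the image under `y` of the grid edge with initial point `q`. -/
noncomputable def edgeLength (y : (Fin (m + 1) → ℕ) → Y) (q : ℕ × (Fin m → ℕ)) : ℝ :=
  dist (y (vecCons q.1 q.2)) (y (vecCons (q.1 + 1) q.2))

/-- The distance of the images under `y` of the corners `0` and `(N, 0, …, 0)` of the grid. It
measures the size of the image of the grid, to which the edge lengths are compared. -/
noncomputable def gridSpan (N : ℕ) (y : (Fin (m + 1) → ℕ) → Y) : ℝ :=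
  dist (y 0) (y (vecCons N 0))

theorem corner_mem_grid : (vecCons N 0 : Fin (m + 1) → ℕ) ∈ grid (m + 1) N :=
  vecCons_mem_grid.2 ⟨le_rfl, zero_mem_grid⟩

theorem le_dist_zero_corner : (N : ℝ) ≤ dist (0 : Fin (m + 1) → ℕ) (vecCons N 0) := by
  rw [← Matrix.cons_zero_zero, dist_vecCons]
  simp [Nat.dist_eq]

section IsQuasisymmetricOn

variable (hy : IsQuasisymmetricOn η y (grid (m + 1) N))
include hy

theorem one_le_gauge_one (hL : 0 < gridSpan N y) : (1 : ℝ) ≤ η 1 :=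
  (le_mul_iff_one_le_left hL).1
    (hy 0 zero_mem_grid _ corner_mem_grid _ corner_mem_grid 1 (by simp))

theorem dist_le_mul_gridSpan {g h : Fin (m + 1) → ℕ} (hg : g ∈ grid (m + 1) N)
    (hh : h ∈ grid (m + 1) N) : dist (y g) (y h) ≤ 2 * η 1 * gridSpan N y := by
  have hzero : ∀ g ∈ grid (m + 1) N, dist (y 0) (y g) ≤ η 1 * gridSpan N y := fun g hg =>
    hy 0 zero_mem_grid g hg _ corner_mem_grid 1 (by
      simpa using (dist_le_of_mem_grid zero_mem_grid hg).trans le_dist_zero_corner)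
  linarith [dist_triangle_left (y g) (y h) (y 0), hzero g hg, hzero h hh]

theorem gridSpan_le_line {h : Fin m → ℕ} (hh : h ∈ grid m N) :
    gridSpan N y ≤ 2 * η 1 * dist (y (vecCons 0 h)) (y (vecCons N h)) := by
  have h₀ : vecCons 0 h ∈ grid (m + 1) N := vecCons_mem_grid.2 ⟨N.zero_le, hh⟩
  have h₁ : vecCons N h ∈ grid (m + 1) N := vecCons_mem_grid.2 ⟨le_rfl, hh⟩
  have hstart : ∀ g ∈ grid (m + 1) N,
      dist (y (vecCons 0 h)) (y g) ≤ η 1 * dist (y (vecCons 0 h)) (y (vecCons N h)) :=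
    fun g hg => hy _ h₀ g hg _ h₁ 1 ((dist_le_of_mem_grid h₀ hg).trans (by
      simp [dist_vecCons, Nat.dist_eq]))
  rw [gridSpan]
  linarith [dist_triangle_left (y 0) (y (vecCons N 0)) (y (vecCons 0 h)), hstart 0 zero_mem_grid,
    hstart _ corner_mem_grid]

theorem pow_mul_gridSpan_le_sum_edgeLength :
    (N : ℝ) ^ m * gridSpan N y ≤ 2 * η 1 * ∑ q ∈ edgeIndex m N, edgeLength y q := by
  have hcard : ((Fintype.piFinset fun _ : Fin m => Finset.range N).card : ℝ) = (N : ℝ) ^ m := by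
    simp
  rw [edgeIndex, Finset.sum_product_right, Finset.mul_sum, ← hcard, ← nsmul_eq_mul]
  refine Finset.card_nsmul_le_sum _ _ _ fun h hh => ?_
  have hh' : h ∈ grid m N := fun i => (Finset.mem_range.1 (Fintype.mem_piFinset.1 hh i)).le
  refine (gridSpan_le_line hy hh').trans ?_
  gcongr
  exact dist_le_range_sum_dist (fun j => y (vecCons j h)) N

theorem gridSpan_pow_le_sum_edgeLength_pow (hN : 0 < N) :
    gridSpan N y ^ (m + 1) ≤
      (2 * η 1) ^ (m + 1) * ∑ q ∈ edgeIndex m N, edgeLength y q ^ (m + 1) := by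
  have hmean : (∑ q ∈ edgeIndex m N, edgeLength y q) ^ (m + 1) ≤
      ((N : ℝ) ^ m) ^ (m + 1) * ∑ q ∈ edgeIndex m N, edgeLength y q ^ (m + 1) := by
    simpa [card_edgeIndex, pow_right_comm] using
      pow_sum_le_card_mul_sum_pow (s := edgeIndex m N) (f := edgeLength y)
        (fun q _ => dist_nonneg) m
  have hL : 0 ≤ gridSpan N y := dist_nonneg
  refine le_of_mul_le_mul_left ?_ (show 0 < ((N : ℝ) ^ m) ^ (m + 1) by positivity)
  calc ((N : ℝ) ^ m) ^ (m + 1) * gridSpan N y ^ (m + 1)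
      = ((N : ℝ) ^ m * gridSpan N y) ^ (m + 1) := (mul_pow _ _ _).symm
    _ ≤ (2 * η 1 * ∑ q ∈ edgeIndex m N, edgeLength y q) ^ (m + 1) :=
      pow_le_pow_left₀ (by positivity) (pow_mul_gridSpan_le_sum_edgeLength hy) _
    _ = (2 * η 1) ^ (m + 1) * (∑ q ∈ edgeIndex m N, edgeLength y q) ^ (m + 1) := mul_pow _ _ _
    _ ≤ (2 * η 1) ^ (m + 1) *
        (((N : ℝ) ^ m) ^ (m + 1) * ∑ q ∈ edgeIndex m N, edgeLength y q ^ (m + 1)) := by gcongr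
    _ = _ := mul_left_comm _ _ _

theorem edgeLength_le_mul_gridSpan (hN : 0 < N) {q : ℕ × (Fin m → ℕ)} (hq : q ∈ edgeIndex m N) :
    edgeLength y q ≤ η (2 / N) * (2 * η 1 * gridSpan N y) := by
  have hN' : (0 : ℝ) < N := Nat.cast_pos.2 hN
  have hg := vecCons_mem_grid_of_mem_edgeIndex hq
  obtain ⟨c, hc, hdist⟩ : ∃ c ∈ grid (m + 1) N, (N : ℝ) ≤ 2 * dist (vecCons q.1 q.2) c := by
    by_contra! hfar
    have h₀ := hfar 0 zero_mem_grid
    have h₁ := hfar _ corner_mem_grid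
    linarith [le_dist_zero_corner (m := m) (N := N),
      dist_triangle_left (0 : Fin (m + 1) → ℕ) (vecCons N 0) (vecCons q.1 q.2)]
  refine (hy _ hg _ (vecCons_succ_mem_grid_of_mem_edgeIndex hq) c hc (2 / N) ?_).trans ?_
  · rw [dist_vecCons_succ, NNReal.coe_div, NNReal.coe_natCast, div_mul_eq_mul_div,
      one_le_div hN']
    exact hdist
  · gcongr
    exact dist_le_mul_gridSpan hy hg hc

theorem edgeLength_le_mul_dist {q q' : ℕ × (Fin m → ℕ)} (hq : q ∈ edgeIndex m N)
    (hq' : q' ∈ edgeIndex m N) (hne : q ≠ q') :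
    edgeLength y q ≤ η 1 * dist (y (vecCons q.1 q.2)) (y (vecCons q'.1 q'.2)) := by
  refine hy _ (vecCons_mem_grid_of_mem_edgeIndex hq) _ (vecCons_succ_mem_grid_of_mem_edgeIndex hq)
    _ (vecCons_mem_grid_of_mem_edgeIndex hq') 1 ?_
  rw [dist_vecCons_succ, NNReal.coe_one, one_mul]
  refine one_le_dist_of_ne fun heq => hne ?_
  obtain ⟨h₁, h₂⟩ := Matrix.vecCons_inj.1 heq
  exact Prod.ext h₁ h₂

end IsQuasisymmetricOn

theorem IsAssouadExponent.exists_card_edges_le {Z : Set Y} {s : ℝ≥0} (hs : IsAssouadExponent Z s)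
    (m : ℕ) (η : ℝ≥0 → ℝ≥0) : ∃ C : ℝ, 0 < C ∧ ∀ (N : ℕ) (y : (Fin (m + 1) → ℕ) → Y),
      IsQuasisymmetricOn η y (grid (m + 1) N) → MapsTo y (grid (m + 1) N) Z →
      0 < gridSpan N y → ∀ r, 0 < r → ∀ B ⊆ edgeIndex m N, (∀ q ∈ B, r ≤ edgeLength y q) →
        (B.card : ℝ) ≤ C * gridSpan N y ^ (s : ℝ) * r ^ (-s : ℝ) := by
  obtain ⟨C, hC, hcard⟩ := hs.exists_card_le
  refine ⟨C * (4 * η 1 ^ 2 + 1) ^ (s : ℝ), by positivity,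
    fun N y hy hyZ hL r hr B hB hBr => ?_⟩
  obtain rfl | ⟨q₀, hq₀⟩ := B.eq_empty_or_nonempty
  · simpa using by positivity
  have hη : (1 : ℝ) ≤ η 1 := one_le_gauge_one hy hL
  have hrL : r ≤ 2 * η 1 * gridSpan N y := (hBr q₀ hq₀).trans (dist_le_mul_gridSpan hy
    (vecCons_mem_grid_of_mem_edgeIndex (hB hq₀)) (vecCons_succ_mem_grid_of_mem_edgeIndex (hB hq₀)))
  have hsep : ∀ q ∈ B, ∀ q' ∈ B, q ≠ q' →
      r / (2 * η 1) < dist (y (vecCons q.1 q.2)) (y (vecCons q'.1 q'.2)) := by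
    intro q hq q' hq' hne
    have hedge := (hBr q hq).trans (edgeLength_le_mul_dist hy (hB hq) (hB hq') hne)
    rw [div_lt_iff₀ (by positivity)]
    linarith
  have hball := hcard B (fun q => y (vecCons q.1 q.2)) (hyZ zero_mem_grid) (by positivity)
    ((div_lt_self hr (by linarith)).trans_le hrL) (fun q hq =>
      have hg := vecCons_mem_grid_of_mem_edgeIndex (hB hq)
      ⟨dist_le_mul_gridSpan hy hg zero_mem_grid, hyZ hg⟩) hsep
  have hratio : 2 * η 1 * gridSpan N y / (r / (2 * η 1)) = 4 * η 1 ^ 2 * gridSpan N y / r := by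
    field_simp
    ring
  calc (B.card : ℝ) ≤ C * (4 * η 1 ^ 2 * gridSpan N y / r) ^ (s : ℝ) := hratio ▸ hball
    _ = C * (4 * η 1 ^ 2) ^ (s : ℝ) * gridSpan N y ^ (s : ℝ) * r ^ (-s : ℝ) := by
      rw [Real.div_rpow (by positivity) hr.le, Real.mul_rpow (by positivity) hL.le,
        Real.rpow_neg hr.le]
      ring
    _ ≤ _ := by
      gcongr
      linarith

theorem IsAssouadExponent.exists_one_le_mul_gauge {Z : Set Y} {s : ℝ≥0}
    (hs : IsAssouadExponent Z s) (hsm : (s : ℝ) < (m + 1 : ℕ)) (η : ℝ≥0 → ℝ≥0) :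
    ∃ C : ℝ, ∀ (N : ℕ) (y : (Fin (m + 1) → ℕ) → Y), 0 < N →
      IsQuasisymmetricOn η y (grid (m + 1) N) → MapsTo y (grid (m + 1) N) Z →
      0 < gridSpan N y → 1 ≤ C * (η (2 / N) : ℝ) ^ (((m + 1 : ℕ) : ℝ) - s) := by
  obtain ⟨C, hC, hcard⟩ := hs.exists_card_edges_le m η
  set p : ℝ := ((m + 1 : ℕ) : ℝ)
  refine ⟨(2 * η 1) ^ (m + 1) * (p * (C * ((2 * η 1) ^ (p - s) / (p - s)))),
    fun N y hN hy hyZ hL => ?_⟩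
  set L := gridSpan N y
  have hlower := gridSpan_pow_le_sum_edgeLength_pow hy hN
  have hupper : ∑ q ∈ edgeIndex m N, edgeLength y q ^ (m + 1) ≤
      p * (C * L ^ (s : ℝ) * ((η (2 / N) * (2 * η 1 * L)) ^ (p - s) / (p - s))) := by
    simp only [← Real.rpow_natCast]
    exact sum_rpow_le_of_card_le (edgeIndex m N) (by positivity) hsm (by positivity)
      (by positivity) (fun q _ => dist_nonneg)
      (fun q hq => edgeLength_le_mul_gridSpan hy hN hq) (hcard N y hy hyZ hL)
  have hLp : L ^ (s : ℝ) * L ^ (p - s) = L ^ (m + 1) := by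
    rw [← Real.rpow_add hL, add_sub_cancel, Real.rpow_natCast]
  refine le_of_mul_le_mul_right ?_ (pow_pos hL (m + 1))
  calc 1 * L ^ (m + 1) ≤ (2 * η 1) ^ (m + 1) *
        (p * (C * L ^ (s : ℝ) * ((η (2 / N) * (2 * η 1 * L)) ^ (p - s) / (p - s)))) := by
        rw [one_mul]
        exact hlower.trans (mul_le_mul_of_nonneg_left hupper (by positivity))
    _ = _ := by
      rw [Real.mul_rpow (by positivity) (by positivity),
        Real.mul_rpow (by positivity) hL.le, ← hLp]
      ring

end Grids

section LargeGrids

variable {X : Type u} [MetricSpace X] {d : ℕ} {F : Set X}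

/-- `F` contains quasi-symmetric images of arbitrarily large integer grids of dimension `d`, with
one linear gauge for all of them. -/
def HasLargeGrids (d : ℕ) (F : Set X) : Prop :=
  ∃ K : ℝ≥0, ∀ N : ℕ, ∃ x : (Fin d → ℕ) → F,
    InjOn x (grid d N) ∧ IsQuasisymmetricOn (K * ·) x (grid d N)

theorem tendsto_homeomorph_nnreal_rpow (η : ℝ≥0 ≃ₜ ℝ≥0) (K : ℝ≥0) {p : ℝ} (hp : 0 < p) :
    Tendsto (fun N : ℕ => (η (K * (2 / N)) : ℝ) ^ p) atTop (𝓝 0) := by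
  have harg : Tendsto (fun N : ℕ => K * (2 / (N : ℝ≥0))) atTop (𝓝 0) := by
    simpa using (tendsto_const_div_atTop_nhds_zero_nat 2).const_mul K
  have hη := (η.continuous.tendsto 0).comp harg
  rw [homeomorph_nnreal_zero] at hη
  simpa [Real.zero_rpow hp.ne'] using (NNReal.tendsto_coe.2 hη).rpow_const (Or.inr hp.le)

theorem HasLargeGrids.le_of_isAssouadExponent {Y : Type*} [MetricSpace Y] {f : F → Y} {s : ℝ≥0}
    (h : HasLargeGrids d F) (hf : IsQuasisymmetric f) (hs : IsAssouadExponent (range f) s) :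
    (d : ℝ≥0) ≤ s := by
  obtain _ | m := d
  · simp
  by_contra! hsm
  obtain ⟨K, h⟩ := h
  choose x hxinj hx using h
  obtain ⟨η, hη⟩ := hf.exists_isQuasisymmetricOn_univ
  obtain ⟨C, hC⟩ := hs.exists_one_le_mul_gauge (by exact_mod_cast hsm) (η ∘ (K * ·))
  have hspan : ∀ N, 0 < N → 0 < gridSpan N (f ∘ x N) := fun N hN => by
    refine dist_pos.2 fun heq => hN.ne ?_
    exact congrFun (hxinj N zero_mem_grid corner_mem_grid (hf.1.injective heq)) 0
  have hone : ∀ᶠ N : ℕ in atTop,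
      1 ≤ C * (η (K * (2 / N)) : ℝ) ^ (((m + 1 : ℕ) : ℝ) - s) :=
    (eventually_gt_atTop 0).mono fun N hN => hC N (f ∘ x N) hN
      (hη.comp (hx N) (mapsTo_univ _ _)) (fun g _ => mem_range_self _) (hspan N hN)
  have hlim := (tendsto_homeomorph_nnreal_rpow η K
    (sub_pos.2 (show (s : ℝ) < (m + 1 : ℕ) by exact_mod_cast hsm))).const_mul C
  rw [mul_zero] at hlim
  exact (ge_of_tendsto hlim hone).not_gt one_pos

theorem HasLargeGrids.le_conformalAssouadDim (h : HasLargeGrids d F) :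
    d ≤ conformalAssouadDim F :=
  le_iInf fun _ => le_iInf fun _ => le_iInf fun _ => le_iInf fun hf => le_iInf₂ fun _ hs => by
    exact_mod_cast h.le_of_isAssouadExponent hf hs

theorem conformalAssouadDim_le_assouadDim (F : Set X) :
    conformalAssouadDim F ≤ assouadDim F := by
  have hval : IsQuasisymmetric (Subtype.val : F → X) :=
    ⟨.subtypeVal, Homeomorph.refl ℝ≥0, fun _ _ _ _ h => h⟩
  refine (iInf₂_le_of_le X ‹_› (iInf₂_le _ hval)).trans_eq ?_
  rw [Subtype.range_coe]

end LargeGrids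

section Tangents

variable {X : Type*} [NormedAddCommGroup X] [NormedSpace ℝ X] {d : ℕ}
  {b : Module.Basis (Fin d) ℝ X} {F : Set X}

theorem IsAlmostDenseInBalls.asymptoticSteinhaus (h : IsAlmostDenseInBalls F) :
    AsymptoticSteinhaus F := by
  intro P hP ε hε
  obtain ⟨M, hM, hPM⟩ := hP.isBounded.exists_pos_norm_le
  obtain ⟨x, R, hR, hx⟩ := h (ε / M) (by positivity)
  set δ := R / M
  have hδ : 0 < δ := by positivity
  have hεδ : ε / M * R = ε * δ := by ring
  refine ⟨δ, hδ, x, {z | z ∈ F ∧ ∃ p ∈ P, dist z (x + δ • p) ≤ ε * δ}, fun z hz => hz.1,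
    hausdorffEDist_le_of_mem_edist ?_ ?_⟩
  · rintro z ⟨-, p, hp, hzp⟩
    exact ⟨_, mem_image_of_mem _ hp, (edist_le_ofReal (by positivity)).2 hzp⟩
  · rintro _ ⟨p, hp, rfl⟩
    have hball : x + δ • p ∈ closedBall x R := by
      rw [mem_closedBall, dist_self_add_left, norm_smul, Real.norm_of_nonneg hδ.le,
        ← div_mul_cancel₀ R hM.ne']
      exact mul_le_mul_of_nonneg_left (hPM p hp) hδ.le
    obtain ⟨z, hz, hpz⟩ := hx _ hball
    rw [hεδ] at hpz
    exact ⟨z, ⟨hz, p, hp, by rwa [dist_comm]⟩, (edist_le_ofReal (by positivity)).2 hpz⟩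

/-- The points `t + δ ∑ i, g i • b i` of which arithmetic patches consist, parametrized by their
coefficients. -/
noncomputable def latticePoint (b : Module.Basis (Fin d) ℝ X) (δ : ℝ) (t : X) (g : Fin d → ℕ) : X :=
  t + δ • ∑ i, (g i : ℝ) • b i

theorem patch_eq_image_latticePoint (b : Module.Basis (Fin d) ℝ X) (k : ℕ) (δ : ℝ) (t : X) :
    patch b k δ t =
      latticePoint b δ t '' (Fintype.piFinset fun _ : Fin d => Finset.range k : Finset _) := by
  ext p
  simp [patch, latticePoint, eq_comm]

theorem add_smul_latticePoint (b : Module.Basis (Fin d) ℝ X) (δ : ℝ) (t : X) (g : Fin d → ℕ) :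
    t + δ • latticePoint b 1 0 g = latticePoint b δ t g := by
  simp [latticePoint]

theorem AsymptoticSteinhaus.asymptoticallyContainsPatches (b : Module.Basis (Fin d) ℝ X)
    (h : AsymptoticSteinhaus F) : AsymptoticallyContainsPatches b F := by
  intro k ε hε
  obtain ⟨δ, hδ, t, E, hE, hEP⟩ := h (patch b k 1 0)
    (patch_eq_image_latticePoint b k 1 0 ▸ (Finset.finite_toSet _).image _) ε hε
  refine ⟨δ, hδ, t, E, hE, ?_⟩
  simpa only [patch_eq_image_latticePoint, image_image, add_smul_latticePoint] using hEP

theorem exists_mul_dist_le_dist_latticePoint (b : Module.Basis (Fin d) ℝ X) :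
    ∃ A B : ℝ≥0, 0 < A ∧ ∀ (δ : ℝ) (t : X) (g h : Fin d → ℕ), 0 ≤ δ →
      A * (δ * dist g h) ≤ dist (latticePoint b δ t g) (latticePoint b δ t h) ∧
      dist (latticePoint b δ t g) (latticePoint b δ t h) ≤ B * (δ * dist g h) := by
  set e := b.equivFunL.symm
  obtain ⟨K, hK⟩ : ∃ K, AntilipschitzWith K e := ⟨_, e.antilipschitz⟩
  obtain ⟨L, hL⟩ : ∃ L, LipschitzWith L e := ⟨_, e.lipschitz⟩
  refine ⟨(K + 1)⁻¹, L, by positivity, fun δ t g h hδ => ?_⟩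
  let c : (Fin d → ℕ) → Fin d → ℝ := fun g i => g i
  have hc : dist (c g) (c h) = dist g h := by simp only [dist_pi_def]; rfl
  have hlattice : ∀ g, latticePoint b δ t g = t + δ • e (c g) := fun g => by
    rw [latticePoint, ← b.equivFun_symm_apply]
    rfl
  rw [hlattice, hlattice, dist_add_left, dist_smul₀, Real.norm_of_nonneg hδ, ← hc]
  constructor
  · rw [NNReal.coe_inv, inv_mul_le_iff₀ (by positivity), mul_left_comm]
    gcongr
    refine (hK.le_mul_dist _ _).trans ?_
    gcongr
    simp
  · rw [mul_left_comm]
    gcongr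
    exact hL.dist_le_mul _ _

theorem isQuasisymmetricOn_of_mul_dist_le {Y Z : Type*} [MetricSpace Y] [MetricSpace Z] {A B : ℝ≥0}
    (hA : 0 < A) {f : Y → Z} {S : Set Y}
    (hlower : ∀ u ∈ S, ∀ v ∈ S, A * dist u v ≤ dist (f u) (f v))
    (hupper : ∀ u ∈ S, ∀ v ∈ S, dist (f u) (f v) ≤ B * dist u v) :
    IsQuasisymmetricOn (B / A * ·) f S := by
  intro u hu a ha c hc t htac
  calc dist (f u) (f a) ≤ B * dist u a := hupper u hu a ha
    _ ≤ B * (t * dist u c) := by gcongr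
    _ = (B / A * t : ℝ≥0) * (A * dist u c) := by
      push_cast
      field_simp
    _ ≤ (B / A * t : ℝ≥0) * dist (f u) (f c) := by
      gcongr
      exact hlower u hu c hc

theorem IsQuasisymmetricOn.of_dilation_comp {Y Z W : Type*} [MetricSpace Y] [MetricSpace Z]
    [MetricSpace W] {η : ℝ≥0 → ℝ≥0} (T : Z →ᵈ W) {f : Y → Z} {S : Set Y}
    (h : IsQuasisymmetricOn η (T ∘ f) S) : IsQuasisymmetricOn η f S := by
  intro u hu a ha c hc t htac
  have hdist := h u hu a ha c hc t htac
  simp only [Function.comp_apply, Dilation.dist_eq, mul_left_comm (η t : ℝ)] at hdist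
  exact le_of_mul_le_mul_left hdist (Dilation.ratio_pos T)

/-- An error of `ε δ`, with `ε` a fixed fraction of the minimal distance of the points of the
lattice of scale `1`, still leaves a map that is bilipschitz up to the scale `δ`. -/
theorem exists_isQuasisymmetricOn_of_dist_latticePoint_le (b : Module.Basis (Fin d) ℝ X) :
    ∃ ε > 0, ∃ K : ℝ≥0, ∀ (S : Set (Fin d → ℕ)) (δ : ℝ) (t : X) (f : (Fin d → ℕ) → X), 0 < δ →
      (∀ g ∈ S, dist (f g) (latticePoint b δ t g) ≤ ε * δ) →
        InjOn f S ∧ IsQuasisymmetricOn (K * ·) f S := by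
  obtain ⟨A, B, hA, hAB⟩ := exists_mul_dist_le_dist_latticePoint b
  refine ⟨A / 4, by positivity, (B + A / 2) / (A / 2), fun S δ t f hδ hf => ?_⟩
  lift δ to ℝ≥0 using hδ.le
  rw [NNReal.coe_pos] at hδ
  have hbounds : ∀ g ∈ S, ∀ h ∈ S, (A / 2 * δ : ℝ≥0) * dist g h ≤ dist (f g) (f h) ∧
      dist (f g) (f h) ≤ ((B + A / 2) * δ : ℝ≥0) * dist g h := by
    intro g hg h hh
    obtain rfl | hne := eq_or_ne g h
    · simp
    have herror : (A / 4 * δ : ℝ) ≤ A / 4 * δ * dist g h :=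
      le_mul_of_one_le_right (by positivity) (one_le_dist_of_ne hne)
    obtain ⟨hlower, hupper⟩ := hAB δ t g h δ.coe_nonneg
    have hfg := hf g hg
    have hfh := hf h hh
    push_cast
    rw [dist_comm] at hfg
    constructor
    · linarith [dist_triangle4 (latticePoint b δ t g) (f g) (f h) (latticePoint b δ t h)]
    · rw [dist_comm] at hfg hfh
      linarith [dist_triangle4 (f g) (latticePoint b δ t g) (latticePoint b δ t h) (f h)]
  refine ⟨fun g hg h hh heq => ?_, ?_⟩
  · have hdist := (hbounds g hg h hh).1
    rw [heq, dist_self] at hdist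
    exact dist_le_zero.1 (nonpos_of_mul_nonpos_right hdist (by positivity))
  · simpa only [mul_div_mul_right _ _ hδ.ne'] using isQuasisymmetricOn_of_mul_dist_le
      (by positivity) (fun g hg h hh => (hbounds g hg h hh).1)
      (fun g hg h hh => (hbounds g hg h hh).2)

theorem hasLargeGrids_of_dist_latticePoint_le (b : Module.Basis (Fin d) ℝ X)
    (h : ∀ ε > 0, ∀ N : ℕ, ∃ (T : X →ᵈ X) (δ : ℝ) (t : X), 0 < δ ∧
      ∀ g ∈ grid d N, ∃ z ∈ F, dist (latticePoint b δ t g) (T z) ≤ ε * δ) : HasLargeGrids d F := by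
  obtain ⟨ε, hε, K, hK⟩ := exists_isQuasisymmetricOn_of_dist_latticePoint_le b
  refine ⟨K, fun N => ?_⟩
  obtain ⟨T, δ, t, hδ, hF⟩ := h ε hε N
  have hF' : ∀ g ∈ grid d N, ∃ z : F, dist (T z) (latticePoint b δ t g) ≤ ε * δ := fun g hg =>
    let ⟨z, hz, hdist⟩ := hF g hg
    ⟨⟨z, hz⟩, by rwa [dist_comm]⟩
  have : Nonempty F := ⟨(hF' 0 zero_mem_grid).choose⟩
  choose! x hx using hF'
  obtain ⟨hinj, hqs⟩ := hK (grid d N) δ t (T.comp isometry_subtype_coe.toDilation ∘ x) hδ hx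
  exact ⟨x, hinj.of_comp, hqs.of_dilation_comp⟩

theorem AsymptoticallyContainsPatches.hasLargeGrids (h : AsymptoticallyContainsPatches b F) :
    HasLargeGrids d F := by
  refine hasLargeGrids_of_dist_latticePoint_le b fun ε hε N => ?_
  obtain ⟨δ, hδ, t, E, hE, hEP⟩ := h (N + 1) (ε / 2) (by positivity)
  refine ⟨Dilation.id X, δ, t, hδ, fun g hg => ?_⟩
  have hlt : hausdorffEDist (patch b (N + 1) δ t) E < ENNReal.ofReal (ε * δ) := by
    rw [hausdorffEDist_comm]
    refine hEP.trans_lt ((ENNReal.ofReal_lt_ofReal_iff (by positivity)).2 ?_)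
    gcongr
    exact half_lt_self hε
  obtain ⟨z, hz, hgz⟩ := exists_edist_lt_of_hausdorffEDist_lt
    (show latticePoint b δ t g ∈ patch b (N + 1) δ t from
      ⟨g, fun i => Nat.lt_succ_of_le (hg i), rfl⟩) hlt
  exact ⟨z, hE hz, (edist_lt_ofReal.1 hgz).le⟩

theorem exists_latticePoint_mem_ball (b : Module.Basis (Fin d) ℝ X) (N : ℕ) (t : X) {ρ : ℝ}
    (hρ : 0 < ρ) : ∃ δ > 0, ∀ g ∈ grid d N, latticePoint b δ t g ∈ ball t ρ := by
  obtain ⟨_, B, -, hB⟩ := exists_mul_dist_le_dist_latticePoint b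
  refine ⟨ρ / (B * N + 1), by positivity, fun g hg => ?_⟩
  have hzero : latticePoint b (ρ / (B * N + 1)) t 0 = t := by simp [latticePoint]
  have hdist := (hB (ρ / (B * N + 1)) t g 0 (by positivity)).2
  rw [hzero] at hdist
  refine mem_ball.2 (hdist.trans_lt ?_)
  calc B * (ρ / (B * N + 1) * dist g 0) ≤ B * (ρ / (B * N + 1) * N) := by
        gcongr
        exact dist_le_of_mem_grid hg zero_mem_grid
    _ = ρ * (B * N) / (B * N + 1) := by ring
    _ < ρ := by
      rw [div_lt_iff₀ (by positivity)]
      gcongr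
      linarith

theorem IsWeakTangent.hasLargeGrids (b : Module.Basis (Fin d) ℝ X) {E : Set X}
    (hE : IsWeakTangent E F) (hint : (interior E).Nonempty) : HasLargeGrids d F := by
  obtain ⟨-, -, T, hT⟩ := hE
  obtain ⟨t, ht⟩ := hint
  obtain ⟨ρ, hρ, hball⟩ := isOpen_iff.1 isOpen_interior t ht
  refine hasLargeGrids_of_dist_latticePoint_le b fun ε hε N => ?_
  obtain ⟨δ, hδ, hgrid⟩ := exists_latticePoint_mem_ball b N t hρ
  obtain ⟨n, hn⟩ := (hT.eventually_lt_const (ENNReal.ofReal_pos.2 (mul_pos hε hδ))).exists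
  refine ⟨T n, δ, t, hδ, fun g hg => ?_⟩
  obtain ⟨_, ⟨⟨z, hz, rfl⟩, -⟩, hgz⟩ :=
    exists_edist_lt_of_hausdorffEDist_lt (interior_subset (hball (hgrid g hg))) hn
  exact ⟨z, hz, (edist_lt_ofReal.1 hgz).le⟩

/-- The similarity that maps the ball of radius `R` about `x` onto the unit ball. -/
noncomputable def normalizingDilation (x : X) {R : ℝ} (hR : 0 < R) : X →ᵈ X :=
  Dilation.mkOfDistEq (fun y => R⁻¹ • (y - x)) ⟨R.toNNReal⁻¹, by simpa using hR, fun y z => by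
    rw [dist_smul₀, dist_sub_right, norm_inv, Real.norm_of_nonneg hR.le, NNReal.coe_inv,
      Real.coe_toNNReal _ hR.le]⟩

theorem exists_dist_normalizingDilation_le {x : X} {R ε : ℝ} (hR : 0 < R)
    (h : ∀ y ∈ closedBall x R, ∃ z ∈ F, dist y z ≤ ε * R) {u : X} (hu : ‖u‖ ≤ 1) :
    ∃ z ∈ F, dist u (normalizingDilation x hR z) ≤ ε := by
  obtain ⟨z, hz, hdist⟩ := h (x + R • u) (by
    rw [mem_closedBall, dist_self_add_left, norm_smul, Real.norm_of_nonneg hR.le]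
    exact mul_le_of_le_one_right hR.le hu)
  refine ⟨z, hz, ?_⟩
  have hu' : u = R⁻¹ • (x + R • u - x) := by rw [add_sub_cancel_left, inv_smul_smul₀ hR.ne']
  change dist u (R⁻¹ • (z - x)) ≤ ε
  rw [hu', dist_smul₀, dist_sub_right, norm_inv, Real.norm_of_nonneg hR.le,
    inv_mul_le_iff₀ hR, mul_comm]
  exact hdist

theorem hausdorffEDist_closedBall_normalizingDilation_le {x : X} {R ε : ℝ} (hR : 0 < R)
    (hε₀ : 0 ≤ ε) (hε₁ : ε ≤ 1) (h : ∀ y ∈ closedBall x R, ∃ z ∈ F, dist y z ≤ ε * R) :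
    hausdorffEDist (closedBall 0 1) (normalizingDilation x hR '' F ∩ closedBall 0 1) ≤
      ENNReal.ofReal (2 * ε) := by
  refine hausdorffEDist_le_of_mem_edist (fun w hw => ?_) fun w hw => ⟨w, hw.2, by simp⟩
  rw [mem_closedBall_zero_iff] at hw
  -- Shrinking `w` first keeps the approximating point inside the unit ball.
  have hshrink : ‖(1 - ε) • w‖ ≤ 1 - ε := by
    rw [norm_smul, Real.norm_of_nonneg (sub_nonneg.2 hε₁)]
    exact mul_le_of_le_one_right (sub_nonneg.2 hε₁) hw
  have hdist : dist w ((1 - ε) • w) ≤ ε := by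
    rw [dist_eq_norm, sub_smul, one_smul, sub_sub_cancel, norm_smul, Real.norm_of_nonneg hε₀]
    exact mul_le_of_le_one_right hε₀ hw
  obtain ⟨z, hz, hwz⟩ := exists_dist_normalizingDilation_le hR h
    (hshrink.trans (sub_le_self 1 hε₀))
  refine ⟨_, ⟨mem_image_of_mem _ hz, ?_⟩, (edist_le_ofReal (by positivity)).2 ?_⟩
  · rw [← dist_zero_left] at hshrink
    rw [mem_closedBall']
    linarith [dist_triangle 0 ((1 - ε) • w) (normalizingDilation x hR z)]
  · linarith [dist_triangle w ((1 - ε) • w) (normalizingDilation x hR z)]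

theorem IsAlmostDenseInBalls.isWeakTangent_closedBall [ProperSpace X] (h : IsAlmostDenseInBalls F) :
    IsWeakTangent (closedBall (0 : X) 1) F := by
  have hpos : ∀ n : ℕ, (0 : ℝ) < 1 / ((n : ℝ) + 1) := fun n => Nat.one_div_pos_of_nat
  choose x R hR hx using fun n : ℕ => h (1 / ((n : ℝ) + 1)) (hpos n)
  refine ⟨isCompact_closedBall 0 1, subset_rfl, fun n => normalizingDilation (x n) (hR n), ?_⟩
  have hlim : Tendsto (fun n : ℕ => ENNReal.ofReal (2 * (1 / ((n : ℝ) + 1)))) atTop (𝓝 0) := by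
    simpa using ENNReal.tendsto_ofReal
      ((tendsto_one_div_add_atTop_nhds_zero_nat (𝕜 := ℝ)).const_mul 2)
  exact tendsto_of_tendsto_of_tendsto_of_le_of_le tendsto_const_nhds hlim (fun _ => zero_le)
    fun n => hausdorffEDist_closedBall_normalizingDilation_le (hR n) (hpos n).le
      (div_le_one_of_le₀ (by simp) (by positivity)) (hx n)

end Tangents

end AssouadPatch

theorem mainTheorem1 {X : Type*} [NormedAddCommGroup X] [NormedSpace ℝ X] (d : ℕ)
    (b : Module.Basis (Fin d) ℝ X) (F : Set X) (hF : F.Nonempty) :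
    List.TFAE [
      AssouadPatch.AsymptoticallyContainsPatches b F,
      AssouadPatch.AsymptoticSteinhaus F,
      AssouadPatch.assouadDim F = d,
      AssouadPatch.conformalAssouadDim F = d,
      ∃ E : Set X, AssouadPatch.IsWeakTangent E F ∧ (interior E).Nonempty,
      AssouadPatch.IsWeakTangent (Metric.closedBall (0 : X) 1) F] := by
  have : FiniteDimensional ℝ X := Module.Finite.of_basis b
  have : ProperSpace X := FiniteDimensional.proper_real X
  have hle := AssouadPatch.assouadDim_le_of_basis b F
  have hconf := AssouadPatch.conformalAssouadDim_le_assouadDim F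
  have hgrid : AssouadPatch.HasLargeGrids d F → AssouadPatch.conformalAssouadDim F = d :=
    fun h => le_antisymm (hconf.trans hle) h.le_conformalAssouadDim
  have hdense : AssouadPatch.assouadDim F = d → AssouadPatch.IsAlmostDenseInBalls F :=
    AssouadPatch.isAlmostDenseInBalls_of_assouadDim_eq b hF
  tfae_have 3 → 2 := fun h => (hdense h).asymptoticSteinhaus
  tfae_have 2 → 1 := fun h => h.asymptoticallyContainsPatches b
  tfae_have 1 → 4 := fun h => hgrid h.hasLargeGrids
  tfae_have 4 → 3 := fun h => le_antisymm hle (h.symm.le.trans hconf)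
  tfae_have 3 → 6 := fun h => (hdense h).isWeakTangent_closedBall
  tfae_have 6 → 5 := fun h => ⟨_, h, 0, Metric.ball_subset_interior_closedBall
    (Metric.mem_ball_self one_pos)⟩
  tfae_have 5 → 4 := fun ⟨_, hE, hint⟩ => hgrid (hE.hasLargeGrids b hint)
  tfae_finish
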